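/- Let $a,b$ be two bosonic modes with Fock bases $\{|n\rangle\}_{n\ge 0}$, and for $T\in[0,1]$ let $B(T)=\exp\!\big(\arccos(\sqrt T)\,(ab^\dagger-a^\dagger b)\big)$ be the unitary of the beam splitter with transmission probability $T$. Let $|\psi\rangle=\sum_{n\ge 0}\psi_n|n\rangle$ be any pure state of mode $a$, i.e. $\sum_n|\psi_n|^2=1$, let $|\Psi_T\rangle=B(T)\,|\psi\rangle_a\otimes|0\rangle_b$ be the state obtained by interfering it with the vacuum, let $\rho_T=\mathrm{Tr}_b\,|\Psi_T\rangle\langle\Psi_T|$ be its reduced state, and let $\mathcal P_\psi(T)=\mathrm{Tr}[\rho_T^2]$ be the purity of the reduced state. Then $\mathcal P_\psi$ is a convex function of $T$ on $[0,1]$, and it attains its minimum over $[0,1]$ at the balanced point $T=1/2$. Equivalently, the entanglement of $|\Psi_T\rangle$ as measured by the mixedness (linear entropy) $\mathcal M_\psi(T)=1-\mathcal P_\psi(T)$ is concave in $T$ on $[0,1]$ and is maximal at $T=1/2$. -/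

import Mathlib

noncomputable section

namespace BeamSplitter

open Finset
open scoped Matrix ComplexConjugate InnerProductSpace

/-- The state space of one bosonic mode: square-summable amplitudes in the Fock basis. -/
abbrev Fock : Type := lp (fun _ : ℕ => ℂ) 2

/-- The state space of two bosonic modes `a`, `b`; the index `(m, k)` is the Fock state with `m`
photons in mode `a` and `k` photons in mode `b`. -/
abbrev Fock2 : Type := lp (fun _ : ℕ × ℕ => ℂ) 2

/-- The Fock state with `n` photons; `ket 0` is the vacuum. -/
def ket (n : ℕ) : Fock := lp.single 2 n 1

theorem summable_sq {ι : Type*} (f : lp (fun _ : ι => ℂ) 2) : Summable fun i => ‖f i‖ ^ 2 := by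
  have := (lp.memℓp f).summable (by norm_num)
  simpa using this

theorem norm_sq_eq {ι : Type*} (f : lp (fun _ : ι => ℂ) 2) : ‖f‖ ^ 2 = ∑' i, ‖f i‖ ^ 2 := by
  have := lp.norm_rpow_eq_tsum (p := 2) (by norm_num) f
  simpa using this

theorem memℓp_two {ι : Type*} {f : ι → ℂ} (h : Summable fun i => ‖f i‖ ^ 2) : Memℓp f 2 := by
  apply memℓp_gen
  simpa using h

/-! ### Product states -/

/-- The product state `ψ ⊗ χ`, with `ψ` in mode `a` and `χ` in mode `b`. -/
def tensor (ψ χ : Fock) : Fock2 :=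
  ⟨fun p => ψ p.1 * χ p.2, memℓp_two (by
    simpa [mul_pow] using (summable_sq ψ).mul_of_nonneg (summable_sq χ)
      (fun _ => by positivity) (fun _ => by positivity))⟩

theorem norm_tensor (ψ χ : Fock) : ‖tensor ψ χ‖ = ‖ψ‖ * ‖χ‖ := by
  have h : ‖tensor ψ χ‖ ^ 2 = (‖ψ‖ * ‖χ‖) ^ 2 := by
    have hs : Summable fun p : ℕ × ℕ => ‖ψ p.1‖ ^ 2 * ‖χ p.2‖ ^ 2 :=
      (summable_sq ψ).mul_of_nonneg (summable_sq χ)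
        (fun _ => by positivity) (fun _ => by positivity)
    rw [mul_pow, norm_sq_eq, norm_sq_eq ψ, norm_sq_eq χ,
      (summable_sq ψ).tsum_mul_tsum (summable_sq χ) hs]
    simp [tensor, mul_pow]
  exact (pow_left_inj₀ (by positivity) (by positivity) two_ne_zero).1 h

/-- The bounded operator `ψ ↦ ψ ⊗ χ`. -/
def tensorRight (χ : Fock) : Fock →L[ℂ] Fock2 :=
  LinearMap.mkContinuous
    { toFun := fun ψ => tensor ψ χ
      map_add' := fun _ _ => by ext p; exact add_mul _ _ _
      map_smul' := fun _ _ => by ext p; exact mul_assoc _ _ _ }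
    ‖χ‖ (fun ψ => by rw [mul_comm]; exact (norm_tensor ψ χ).le)

/-! ### The beam splitter -/

/-- The matrix of the annihilation operator in the Fock basis: `a |n⟩ = √n |n - 1⟩`, so that
`annih m n = ⟨m| a |n⟩`. The matrix of the creation operator is its conjugate transpose. -/
def annih : Matrix ℕ ℕ ℂ := fun m n => if n = m + 1 then (Real.sqrt n : ℂ) else 0

/-- The matrix of `a b† - a† b` in the two-mode Fock basis. -/
def generator : Matrix (ℕ × ℕ) (ℕ × ℕ) ℂ := fun p q =>
  annih p.1 q.1 * annihᴴ p.2 q.2 - annihᴴ p.1 q.1 * annih p.2 q.2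

/-- `a b† - a† b` preserves the total number of photons. -/
theorem generator_eq_zero {p q : ℕ × ℕ} (h : p.1 + p.2 ≠ q.1 + q.2) : generator p q = 0 := by
  have h1 : annih p.1 q.1 * annihᴴ p.2 q.2 = 0 := by
    simp only [annih, Matrix.conjTranspose_apply]
    split_ifs <;> first | omega | simp
  have h2 : annihᴴ p.1 q.1 * annih p.2 q.2 = 0 := by
    simp only [annih, Matrix.conjTranspose_apply]
    split_ifs <;> first | omega | simp
  rw [generator, h1, h2, sub_zero]

/-- The restriction of `a b† - a† b` to the space of states with `N` photons in total, which has
the Fock states `(m, k)` with `m + k = N` as a basis. -/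
def sectorGenerator (N : ℕ) : Matrix (antidiagonal N) (antidiagonal N) ℂ :=
  generator.submatrix Subtype.val Subtype.val

/-- The restriction of `exp (θ (a b† - a† b))` to the space of states with `N` photons in total. -/
def sectorUnitary (θ : ℝ) (N : ℕ) : Matrix (antidiagonal N) (antidiagonal N) ℂ :=
  NormedSpace.exp ((θ : ℂ) • sectorGenerator N)

theorem sectorUnitary_conjTranspose_mul (θ : ℝ) (N : ℕ) :
    (sectorUnitary θ N)ᴴ * sectorUnitary θ N = 1 := by
  have h : ((θ : ℂ) • sectorGenerator N)ᴴ = -((θ : ℂ) • sectorGenerator N) := by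
    ext p q
    simp [sectorGenerator, generator, Matrix.conjTranspose_apply]
    ring
  rw [sectorUnitary, ← Matrix.exp_conjTranspose, h,
    ← Matrix.exp_add_of_commute (-((θ : ℂ) • sectorGenerator N)) _
      (Commute.neg_left (Commute.refl ((θ : ℂ) • sectorGenerator N))), neg_add_cancel,
    NormedSpace.exp_zero]

theorem sum_norm_sectorUnitary (θ : ℝ) (N : ℕ) (v : antidiagonal N → ℂ) :
    ∑ p, ‖(sectorUnitary θ N *ᵥ v) p‖ ^ 2 = ∑ p, ‖v p‖ ^ 2 := by
  have key : ∀ w : antidiagonal N → ℂ, ((∑ p, ‖w p‖ ^ 2 : ℝ) : ℂ) = star w ⬝ᵥ w := fun w => by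
    simp [dotProduct, ← Complex.conj_mul']
  have h : star (sectorUnitary θ N *ᵥ v) ⬝ᵥ (sectorUnitary θ N *ᵥ v) = star v ⬝ᵥ v := by
    rw [Matrix.star_mulVec, Matrix.dotProduct_mulVec, Matrix.vecMul_vecMul,
      sectorUnitary_conjTranspose_mul, Matrix.vecMul_one]
  exact_mod_cast (key _).trans (h.trans (key v).symm)

/-- The amplitudes of `exp (θ (a b† - a† b)) Φ`. -/
def rotate (θ : ℝ) (Φ : ℕ × ℕ → ℂ) (p : ℕ × ℕ) : ℂ :=
  (sectorUnitary θ (p.1 + p.2) *ᵥ fun q => Φ q) ⟨p, mem_antidiagonal.2 rfl⟩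

theorem rotate_apply (θ : ℝ) (Φ : ℕ × ℕ → ℂ) (N : ℕ) (p : antidiagonal N) :
    rotate θ Φ p = (sectorUnitary θ N *ᵥ fun q => Φ q) p := by
  obtain ⟨p, hp⟩ := p
  obtain rfl := mem_antidiagonal.1 hp
  rfl

theorem hasSum_of_sector {f g : ℕ × ℕ → ℝ} {s : ℝ} (hf : HasSum f s) (hg : ∀ p, 0 ≤ g p)
    (h : ∀ N, ∑ p : antidiagonal N, g p.1 = ∑ p : antidiagonal N, f p.1) : HasSum g s := by
  let e : (Σ N : ℕ, antidiagonal N) ≃ ℕ × ℕ := HasAntidiagonal.sigmaAntidiagonalEquivProd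
  have h1 : HasSum (fun N => ∑ p : antidiagonal N, f p.1) s :=
    (e.hasSum_iff.2 hf).sigma fun N => hasSum_fintype _
  have hs : Summable (g ∘ e) := by
    refine (summable_sigma_of_nonneg fun _ => hg _).2
      ⟨fun N => (hasSum_fintype _).summable, ?_⟩
    refine h1.summable.congr fun N => ?_
    rw [tsum_fintype]
    exact (h N).symm
  have h2 : HasSum (fun N => ∑ p : antidiagonal N, g p.1) (∑' x, (g ∘ e) x) :=
    hs.hasSum.sigma fun N => hasSum_fintype _
  simp only [h] at h2
  rw [← h2.unique h1]
  exact e.hasSum_iff.1 hs.hasSum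

theorem hasSum_rotate (θ : ℝ) (Φ : Fock2) :
    HasSum (fun p => ‖rotate θ Φ p‖ ^ 2) (‖Φ‖ ^ 2) := by
  have h1 : HasSum (fun p => ‖Φ p‖ ^ 2) (‖Φ‖ ^ 2) := by
    rw [norm_sq_eq]; exact (summable_sq Φ).hasSum
  refine hasSum_of_sector h1 (fun p => by positivity) fun N => ?_
  simp only [rotate_apply]
  exact sum_norm_sectorUnitary θ N fun q => Φ q

/-- The isometry `exp (θ (a b† - a† b))` of the two-mode state space. -/
def rotation (θ : ℝ) : Fock2 →ₗᵢ[ℂ] Fock2 where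
  toFun Φ := ⟨rotate θ Φ, memℓp_two (hasSum_rotate θ Φ).summable⟩
  map_add' Φ Φ' := by
    ext p
    exact congrFun (Matrix.mulVec_add (sectorUnitary θ (p.1 + p.2)) (fun q => Φ q) fun q => Φ' q)
      ⟨p, mem_antidiagonal.2 rfl⟩
  map_smul' c Φ := by
    ext p
    exact congrFun (Matrix.mulVec_smul (sectorUnitary θ (p.1 + p.2)) c fun q => Φ q)
      ⟨p, mem_antidiagonal.2 rfl⟩
  norm_map' Φ := by
    refine (pow_left_inj₀ (norm_nonneg _) (norm_nonneg _) two_ne_zero).1 ?_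
    rw [norm_sq_eq]
    exact (hasSum_rotate θ Φ).tsum_eq

/-- The beam splitter `B(T) = exp (arccos √T (a b† - a† b))` with transmission probability `T`. -/
def beamSplitter (T : ℝ) : Fock2 →ₗᵢ[ℂ] Fock2 := rotation (Real.arccos (Real.sqrt T))

/-- The state `B(T) (ψ ⊗ |0⟩)` that results from interfering `ψ` with the vacuum. -/
def output (ψ : Fock) (T : ℝ) : Fock2 := beamSplitter T (tensor ψ (ket 0))

/-! ### Reduced states and purity -/

/-- The partial trace over mode `b`: the sum over `k` of `⟨k|_b X |k⟩_b`, convergent in operator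
norm. -/
def partialTrace (X : Fock2 →L[ℂ] Fock2) : Fock →L[ℂ] Fock :=
  ∑' k, (tensorRight (ket k)).adjoint ∘L X ∘L tensorRight (ket k)

/-- The trace, computed in the Fock basis. -/
def trace (A : Fock →L[ℂ] Fock) : ℂ := ∑' n, ⟪ket n, A (ket n)⟫_ℂ

/-- The reduced state of mode `a`: the partial trace over `b` of `|Ψ⟩⟨Ψ|`. -/
def reducedState (Ψ : Fock2) : Fock →L[ℂ] Fock :=
  partialTrace (InnerProductSpace.rankOne ℂ Ψ Ψ)

/-- The purity `Tr ρ²` (a real number for self-adjoint `ρ`). -/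
def purity (ρ : Fock →L[ℂ] Fock) : ℝ := (trace (ρ ∘L ρ)).re

/-- The purity of the reduced state of `B(T) (ψ ⊗ |0⟩)`, as a function of `T`. -/
def outputPurity (ψ : Fock) (T : ℝ) : ℝ := purity (reducedState (output ψ T))

/-- The mixedness (linear entropy) of the reduced state of `B(T) (ψ ⊗ |0⟩)`. -/
def outputMixedness (ψ : Fock) (T : ℝ) : ℝ := 1 - outputPurity ψ T

/-! ### Convergence of the series in the partial trace and in the purity -/

theorem adjoint_tensorRight_ket (k : ℕ) (Ψ : Fock2) (m : ℕ) :
    (tensorRight (ket k)).adjoint Ψ m = Ψ (m, k) := by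
  have h : tensorRight (ket k) (lp.single 2 m (1 : ℂ)) = lp.single 2 (m, k) (1 : ℂ) := by
    ext p
    change (lp.single 2 m (1 : ℂ) : Fock) p.1 * (ket k) p.2 = _
    simp only [ket, lp.single_apply, Pi.single_apply, Prod.ext_iff]
    split_ifs <;> simp_all
  have h1 := ContinuousLinearMap.adjoint_inner_right (tensorRight (ket k))
    (lp.single 2 m (1 : ℂ)) Ψ
  rw [h, lp.inner_single_left, lp.inner_single_left] at h1
  simpa using h1

theorem reducedState_term (Ψ : Fock2) (k : ℕ) :
    (tensorRight (ket k)).adjoint ∘L InnerProductSpace.rankOne ℂ Ψ Ψ ∘L tensorRight (ket k) =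
      InnerProductSpace.rankOne ℂ ((tensorRight (ket k)).adjoint Ψ)
        ((tensorRight (ket k)).adjoint Ψ) := by
  rw [InnerProductSpace.rankOne_comp, InnerProductSpace.comp_rankOne]

theorem hasSum_norm_sq_slice (Ψ : Fock2) :
    HasSum (fun k => ‖(tensorRight (ket k)).adjoint Ψ‖ ^ 2) (‖Ψ‖ ^ 2) := by
  have h1 : HasSum (fun p => ‖Ψ p‖ ^ 2) (‖Ψ‖ ^ 2) := by
    rw [norm_sq_eq]; exact (summable_sq Ψ).hasSum
  rw [← (Equiv.prodComm ℕ ℕ).hasSum_iff] at h1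
  refine h1.prod_fiberwise fun k => ?_
  rw [norm_sq_eq]
  simp only [adjoint_tensorRight_ket]
  exact (h1.summable.prod_factor k).hasSum

/-- The series that defines the reduced state converges in operator norm. -/
theorem hasSum_reducedState (Ψ : Fock2) :
    HasSum (fun k => InnerProductSpace.rankOne ℂ ((tensorRight (ket k)).adjoint Ψ)
      ((tensorRight (ket k)).adjoint Ψ)) (reducedState Ψ) := by
  have hs : Summable fun k => InnerProductSpace.rankOne ℂ ((tensorRight (ket k)).adjoint Ψ)
      ((tensorRight (ket k)).adjoint Ψ) := by
    refine Summable.of_norm ?_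
    simpa [← sq] using (hasSum_norm_sq_slice Ψ).summable
  simpa only [reducedState, partialTrace, reducedState_term] using hs.hasSum

/-- The matrix of the reduced state in the Fock basis. -/
theorem hasSum_reducedState_apply (Ψ : Fock2) (m n : ℕ) :
    HasSum (fun k => Ψ (m, k) * conj (Ψ (n, k))) (reducedState Ψ (ket n) m) := by
  have h := (hasSum_reducedState Ψ).mapL
    ((innerSL ℂ (ket m)) ∘L (ContinuousLinearMap.apply ℂ Fock (ket n)))
  have e : ∀ (f : Fock) (j : ℕ), ⟪ket j, f⟫_ℂ = f j := fun f j => by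
    simp [ket, lp.inner_single_left]
  have e' : ∀ (f : Fock) (j : ℕ), ⟪f, ket j⟫_ℂ = conj (f j) := fun f j => by
    simp [ket, lp.inner_single_right]
  simpa [e, e', adjoint_tensorRight_ket, mul_comm] using h

theorem isSelfAdjoint_reducedState (Ψ : Fock2) : IsSelfAdjoint (reducedState Ψ) := by
  have h := (hasSum_reducedState Ψ).star
  refine h.unique ?_
  convert hasSum_reducedState Ψ using 2 with k
  rw [ContinuousLinearMap.star_eq_adjoint, InnerProductSpace.adjoint_rankOne]

/-- The series that defines the purity of the reduced state converges. -/
theorem summable_purity (Ψ : Fock2) :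
    Summable fun n => ⟪ket n, (reducedState Ψ ∘L reducedState Ψ) (ket n)⟫_ℂ := by
  have hΨ : Summable fun p => ‖Ψ p‖ ^ 2 := summable_sq Ψ
  have hslice := hasSum_norm_sq_slice Ψ
  have key : ∀ n, ‖reducedState Ψ (ket n)‖ ^ 2 ≤ (∑' k, ‖Ψ (n, k)‖ ^ 2) * ‖Ψ‖ ^ 2 := by
    intro n
    have hrow : Summable fun k => ‖Ψ (n, k)‖ ^ 2 := hΨ.prod_factor n
    have h1 := (hasSum_reducedState Ψ).mapL (ContinuousLinearMap.apply ℂ Fock (ket n))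
    have e' : ∀ f : Fock, ⟪f, ket n⟫_ℂ = conj (f n) := fun f => by
      simp [ket, lp.inner_single_right]
    simp only [ContinuousLinearMap.apply_apply, InnerProductSpace.rankOne_apply, e',
      adjoint_tensorRight_ket] at h1
    have hcs := Real.summable_and_inner_le_Lp_mul_Lq_tsum_of_nonneg (Real.HolderConjugate.two_two)
      (f := fun k => ‖Ψ (n, k)‖) (g := fun k => ‖(tensorRight (ket k)).adjoint Ψ‖)
      (fun _ => norm_nonneg _) (fun _ => norm_nonneg _)
      (by simpa using hrow) (by simpa using hslice.summable)
    have h2 : ‖reducedState Ψ (ket n)‖ ≤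
        ∑' k, ‖Ψ (n, k)‖ * ‖(tensorRight (ket k)).adjoint Ψ‖ := by
      rw [← h1.tsum_eq]
      refine tsum_of_norm_bounded hcs.1.hasSum fun k => ?_
      rw [norm_smul, RCLike.norm_conj]
    have h3 := h2.trans hcs.2
    simp only [Real.rpow_two, hslice.tsum_eq, ← Real.sqrt_eq_rpow] at h3
    calc _ ≤ _ := pow_le_pow_left₀ (norm_nonneg _) h3 2
      _ = _ := by
        rw [mul_pow, Real.sq_sqrt (tsum_nonneg fun _ => by positivity),
          Real.sq_sqrt (by positivity)]
  have hs : Summable fun n => (∑' k, ‖Ψ (n, k)‖ ^ 2) * ‖Ψ‖ ^ 2 := hΨ.prod.mul_right _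
  refine Summable.of_norm_bounded hs fun n => ?_
  have h4 : ⟪ket n, (reducedState Ψ ∘L reducedState Ψ) (ket n)⟫_ℂ =
      ⟪reducedState Ψ (ket n), reducedState Ψ (ket n)⟫_ℂ := by
    rw [ContinuousLinearMap.comp_apply, ← ContinuousLinearMap.adjoint_inner_left,
      ContinuousLinearMap.isSelfAdjoint_iff'.1 (isSelfAdjoint_reducedState Ψ)]
  rw [h4, inner_self_eq_norm_sq_to_K, norm_pow, RCLike.norm_ofReal, abs_norm]
  exact key n

end BeamSplitter

end

/-! The part of the purity that comes from `N` photons in total pairs two copies of the input (with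
amplitudes rescaled by `√n!`) and two conjugate copies with the `N`-th divided power of
`T (y ⊗ x + x ⊗ y) + (1 - T) (x ⊗ x + y ⊗ y)`, where `x` and `y` stand for the creation operators of
the two copies. The variables `x + y` and `x - y` diagonalize this tensor: it equals
`(1/2) (x + y) ⊗ (x + y) + (1/2) (1 - 2 T) (x - y) ⊗ (x - y)`. Hence the purity is a power series in
`1 - 2 T` whose coefficients are nonnegative, being sums of the probabilities of the outcomes when
two copies of the input interfere on a balanced beam splitter. Since the two copies are identical,
no odd number of photons leaves through the port `x - y`, so only even powers of `1 - 2 T` occur,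
and these are convex and minimal at `T = 1/2`. -/

noncomputable section

namespace BeamSplitter

open Finset
open scoped Matrix ComplexConjugate InnerProductSpace Nat TensorProduct

section Series

variable {ι κ α : Type*}

theorem hasSum_sum_fiberwise [AddCommMonoid α] [TopologicalSpace α] [ContinuousAdd α]
    [RegularSpace α] {f : ι → α} {a : α} (hf : HasSum f a) (g : ι → κ) (t : κ → Finset ι)
    (ht : ∀ i c, i ∈ t c ↔ g i = c) : HasSum (fun c => ∑ i ∈ t c, f i) a := by
  refine ((Equiv.sigmaFiberEquiv g).hasSum_iff.2 hf).sigma fun c => ?_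
  exact (Equiv.subtypeEquivRight (ht · c)).hasSum_iff.1 ((t c).hasSum f)

theorem convexOn_of_hasSum {E : Type*} [AddCommMonoid E] [Module ℝ E] {s : Set E} (hs : Convex ℝ s)
    {f : ι → E → ℝ} {F : E → ℝ} (hf : ∀ i, ConvexOn ℝ s (f i))
    (hF : ∀ x ∈ s, HasSum (fun i => f i x) (F x)) : ConvexOn ℝ s F :=
  ⟨hs, fun _ hx _ hy _ _ ha hb hab => hasSum_le (fun i => (hf i).2 hx hy ha hb hab)
    (hF _ (hs hx hy ha hb hab)) (((hF _ hx).const_smul _).add ((hF _ hy).const_smul _))⟩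

theorem isMinOn_of_hasSum {E : Type*} {s : Set E} {f : ι → E → ℝ} {F : E → ℝ} {x : E}
    (hx : x ∈ s) (hf : ∀ i, IsMinOn (f i) s x) (hF : ∀ y ∈ s, HasSum (fun i => f i y) (F y)) :
    IsMinOn F s x :=
  fun _ hy => hasSum_le (fun i => hf i hy) (hF x hx) (hF _ hy)

end Series

section LinearODE

attribute [local instance] Matrix.linftyOpNormedRing Matrix.linftyOpNormedAlgebra

theorem eq_exp_smul_mulVec_of_hasDerivAt {𝕜 n : Type*} [RCLike 𝕜] [Fintype n] [DecidableEq n]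
    {A : Matrix n n 𝕜} {v : ℝ → n → 𝕜} (hv : ∀ t, HasDerivAt v (A *ᵥ v t) t) (t : ℝ) :
    v t = NormedSpace.exp (t • A) *ᵥ v 0 := by
  have hA : LipschitzWith _ (A *ᵥ ·) := (LinearMap.toContinuousLinearMap A.mulVecLin).lipschitz
  have hexp (t : ℝ) : HasDerivAt (fun t : ℝ => NormedSpace.exp (t • A) *ᵥ v 0)
      (A *ᵥ (NormedSpace.exp (t • A) *ᵥ v 0)) t := by
    let evalAt : Matrix n n 𝕜 →L[ℝ] n → 𝕜 :=
      LinearMap.toContinuousLinearMap ((Matrix.mulVecBilin ℝ ℝ).flip (v 0))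
    rw [Matrix.mulVec_mulVec]
    exact evalAt.hasFDerivAt.comp_hasDerivAt t (hasDerivAt_exp_smul_const' A t)
  refine congrFun (ODE_solution_unique_univ (v := fun _ => (A *ᵥ ·)) (s := fun _ => Set.univ)
    (t₀ := 0) (fun _ => hA.lipschitzOnWith) (fun t => ⟨hv t, trivial⟩)
    (fun t => ⟨hexp t, trivial⟩) ?_) t
  simp

end LinearODE

section CoherentState

/-- The amplitude `zⁿ / √n!` of the Fock state `|n⟩` in the unnormalized coherent state with real
parameter `z`, i.e. the eigenvector of the annihilation operator for the eigenvalue `z`. -/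
def coherentAmplitude (z : ℝ) (n : ℕ) : ℝ := z ^ n / √(n ! : ℝ)

theorem sqrt_succ_mul_coherentAmplitude (z : ℝ) (n : ℕ) :
    √((n + 1 : ℕ) : ℝ) * coherentAmplitude z (n + 1) = z * coherentAmplitude z n := by
  have hn : √((n + 1 : ℕ) : ℝ) ≠ 0 := by positivity
  rw [coherentAmplitude, coherentAmplitude, Nat.factorial_succ, Nat.cast_mul,
    Real.sqrt_mul (Nat.cast_nonneg _)]
  field_simp
  ring

theorem coherentAmplitude_zero_left (n : ℕ) : coherentAmplitude 0 n = if n = 0 then 1 else 0 := by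
  rcases n with _ | n <;> simp [coherentAmplitude]

theorem coherentAmplitude_sq {z : ℝ} (hz : 0 ≤ z) (n : ℕ) :
    coherentAmplitude √z n ^ 2 = z ^ n / (n ! : ℝ) := by
  rw [coherentAmplitude, div_pow, Real.sq_sqrt (Nat.cast_nonneg _), pow_right_comm,
    Real.sq_sqrt hz]

theorem hasDerivAt_coherentAmplitude (z : ℝ) (n : ℕ) :
    HasDerivAt (coherentAmplitude · n) (√(n : ℝ) * coherentAmplitude z (n - 1)) z := by
  refine ((hasDerivAt_pow n z).div_const √(n ! : ℝ)).congr_deriv ?_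
  rcases n with _ | n
  · simp
  · have hn : √((n + 1 : ℕ) : ℝ) ≠ 0 := by positivity
    rw [Nat.add_sub_cancel, coherentAmplitude, Nat.factorial_succ, Nat.cast_mul,
      Real.sqrt_mul (Nat.cast_nonneg _)]
    field_simp
    rw [Real.sq_sqrt (Nat.cast_nonneg _), mul_comm]

/-- The amplitude of `|m, k⟩` in the product of the coherent states with parameters `cos θ` and
`sin θ`, into which `exp (θ (a b† - a† b))` turns the product of the coherent states with
parameters `1` and `0`. -/
def rotatedAmplitude (θ : ℝ) (p : ℕ × ℕ) : ℝ :=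
  coherentAmplitude (Real.cos θ) p.1 * coherentAmplitude (Real.sin θ) p.2

theorem hasDerivAt_rotatedAmplitude (θ : ℝ) (m k : ℕ) :
    HasDerivAt (rotatedAmplitude · (m, k))
      (√((m + 1 : ℕ) : ℝ) * √(k : ℝ) * rotatedAmplitude θ (m + 1, k - 1) -
        √(m : ℝ) * √((k + 1 : ℕ) : ℝ) * rotatedAmplitude θ (m - 1, k + 1)) θ := by
  refine (((hasDerivAt_coherentAmplitude _ m).comp θ (Real.hasDerivAt_cos θ)).mul
    ((hasDerivAt_coherentAmplitude _ k).comp θ (Real.hasDerivAt_sin θ))).congr_deriv ?_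
  simp only [rotatedAmplitude, Function.comp_apply]
  linear_combination
    -(√(k : ℝ) * coherentAmplitude (Real.sin θ) (k - 1)) *
        sqrt_succ_mul_coherentAmplitude (Real.cos θ) m +
      √(m : ℝ) * coherentAmplitude (Real.cos θ) (m - 1) *
        sqrt_succ_mul_coherentAmplitude (Real.sin θ) k

theorem sum_annih_mul_conjTranspose_annih (f : ℕ × ℕ → ℂ) (m k : ℕ) :
    ∑ q ∈ antidiagonal (m + k), annih m q.1 * annihᴴ k q.2 * f q =
      √((m + 1 : ℕ) : ℝ) * √(k : ℝ) * f (m + 1, k - 1) := by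
  rcases k with _ | k
  · simp [annih]
  · rw [sum_eq_single_of_mem (m + 1, k) (by simp; omega)]
    · simp [annih]
    · rintro ⟨a, b⟩ hq hne
      have ha : a ≠ m + 1 := by
        rintro rfl
        exact hne (by simp at hq ⊢; omega)
      simp [annih, ha]

theorem sectorGenerator_mulVec {N : ℕ} (f : ℕ × ℕ → ℂ) (p : antidiagonal N) :
    (sectorGenerator N *ᵥ fun q => f q) p =
      √((p.1.1 + 1 : ℕ) : ℝ) * √(p.1.2 : ℝ) * f (p.1.1 + 1, p.1.2 - 1) -
        √(p.1.1 : ℝ) * √((p.1.2 + 1 : ℕ) : ℝ) * f (p.1.1 - 1, p.1.2 + 1) := by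
  obtain ⟨⟨m, k⟩, hp⟩ := p
  obtain rfl : m + k = N := mem_antidiagonal.1 hp
  have hraise := sum_annih_mul_conjTranspose_annih f m k
  have hlower := sum_annih_mul_conjTranspose_annih (f ∘ Prod.swap) k m
  rw [add_comm k m, ← Nat.sum_antidiagonal_swap] at hlower
  simp only [Matrix.mulVec, dotProduct, sectorGenerator, Matrix.submatrix_apply]
  rw [sum_coe_sort (antidiagonal (m + k)) fun q => generator (m, k) q * f q]
  simp only [generator, sub_mul, sum_sub_distrib, hraise]
  simp only [Function.comp_apply, Prod.swap_swap, Prod.fst_swap, Prod.snd_swap, Prod.swap_prod_mk,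
    mul_comm (annih k _)] at hlower
  rw [hlower, mul_comm (√((k + 1 : ℕ) : ℝ) : ℂ)]

theorem hasDerivAt_sector_rotatedAmplitude (N : ℕ) (θ : ℝ) :
    HasDerivAt (fun θ (p : antidiagonal N) => (rotatedAmplitude θ p : ℂ))
      (sectorGenerator N *ᵥ fun p => (rotatedAmplitude θ p.1 : ℂ)) θ := by
  refine hasDerivAt_pi.2 fun p => ?_
  rw [sectorGenerator_mulVec fun q => (rotatedAmplitude θ q : ℂ)]
  exact_mod_cast (hasDerivAt_rotatedAmplitude θ p.1.1 p.1.2).ofReal_comp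

theorem sectorUnitary_mulVec_rotatedAmplitude (θ : ℝ) (N : ℕ) :
    (sectorUnitary θ N *ᵥ fun p => (rotatedAmplitude 0 p.1 : ℂ)) =
      fun p => (rotatedAmplitude θ p.1 : ℂ) :=
  (eq_exp_smul_mulVec_of_hasDerivAt (hasDerivAt_sector_rotatedAmplitude N) θ).symm

/-- The amplitudes of an input state, rescaled so that those of the output state factorize into
them and coherent amplitudes. -/
def scaledAmplitude (ψ : Fock) (n : ℕ) : ℂ := ψ n * √(n ! : ℝ)

theorem tensor_ket_zero_apply (ψ : Fock) (m k : ℕ) :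
    tensor ψ (ket 0) (m, k) = scaledAmplitude ψ (m + k) * rotatedAmplitude 0 (m, k) := by
  change ψ m * (lp.single 2 0 (1 : ℂ) : Fock) k = _
  rw [lp.single_apply, Pi.single_apply, rotatedAmplitude, Real.sin_zero,
    coherentAmplitude_zero_left]
  split_ifs with hk
  · have hm : (√(m ! : ℝ) : ℂ) ≠ 0 := by
      exact_mod_cast (Real.sqrt_pos.2 (Nat.cast_pos.2 m.factorial_pos)).ne'
    subst hk
    simp [scaledAmplitude, coherentAmplitude, hm]
  · simp

theorem rotate_tensor_ket_zero (θ : ℝ) (ψ : Fock) (m k : ℕ) :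
    rotate θ (tensor ψ (ket 0)) (m, k) =
      scaledAmplitude ψ (m + k) * rotatedAmplitude θ (m, k) := by
  have hinput : (fun q : antidiagonal (m + k) => tensor ψ (ket 0) q) =
      scaledAmplitude ψ (m + k) • fun q => (rotatedAmplitude 0 q.1 : ℂ) := by
    ext ⟨⟨a, b⟩, hq⟩
    have hab : a + b = m + k := mem_antidiagonal.1 hq
    rw [tensor_ket_zero_apply, hab]
    rfl
  rw [rotate, hinput, Matrix.mulVec_smul, sectorUnitary_mulVec_rotatedAmplitude]
  rfl

theorem output_apply (ψ : Fock) {T : ℝ} (hT : T ∈ Set.Icc (0 : ℝ) 1) (m k : ℕ) :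
    output ψ T (m, k) = scaledAmplitude ψ (m + k) *
      (coherentAmplitude √T m * coherentAmplitude √(1 - T) k) := by
  have hcos : Real.cos (Real.arccos √T) = √T :=
    Real.cos_arccos (by linarith [Real.sqrt_nonneg T]) (Real.sqrt_le_one.2 hT.2)
  have hsin : Real.sin (Real.arccos √T) = √(1 - T) := by
    rw [Real.sin_arccos, Real.sq_sqrt hT.1]
  have h := rotate_tensor_ket_zero (Real.arccos √T) ψ m k
  rw [rotatedAmplitude, hcos, hsin] at h
  exact_mod_cast h

end CoherentState

section Purity

theorem purity_eq_tsum_norm_sq {A : Fock →L[ℂ] Fock} (hA : IsSelfAdjoint A) :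
    purity A = ∑' n, ‖A (ket n)‖ ^ 2 := by
  have hdiag (n : ℕ) : ⟪ket n, (A ∘L A) (ket n)⟫_ℂ = ((‖A (ket n)‖ ^ 2 : ℝ) : ℂ) := by
    rw [ContinuousLinearMap.comp_apply, ← ContinuousLinearMap.adjoint_inner_left,
      ContinuousLinearMap.isSelfAdjoint_iff'.1 hA, inner_self_eq_norm_sq_to_K]
    norm_cast
  rw [purity, trace, tsum_congr hdiag, ← Complex.ofReal_tsum, Complex.ofReal_re]

theorem summable_mul_conj_mul_conj {ι κ 𝕜 : Type*} [RCLike 𝕜] {f : ι × κ → 𝕜}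
    (hf : Summable fun p => ‖f p‖ ^ 2) :
    Summable fun x : (ι × ι) × (κ × κ) => f (x.1.2, x.2.1) * conj (f (x.1.1, x.2.1)) *
      conj (f (x.1.2, x.2.2) * conj (f (x.1.1, x.2.2))) := by
  have hparallel : Summable fun x : (ι × ι) × (κ × κ) =>
      ‖f (x.1.1, x.2.1)‖ ^ 2 * ‖f (x.1.2, x.2.2)‖ ^ 2 :=
    (Equiv.prodProdProdComm ι ι κ κ).summable_iff.2
      (hf.mul_of_nonneg hf (fun _ => sq_nonneg _) fun _ => sq_nonneg _)
  have hcrossed : Summable fun x : (ι × ι) × (κ × κ) =>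
      ‖f (x.1.2, x.2.1)‖ ^ 2 * ‖f (x.1.1, x.2.2)‖ ^ 2 :=
    ((Equiv.prodComm ι ι).prodCongr (Equiv.refl (κ × κ))).summable_iff.2 hparallel
  refine Summable.of_norm_bounded (hcrossed.add hparallel) fun x => ?_
  simp only [norm_mul, RCLike.norm_conj]
  nlinarith [sq_nonneg (‖f (x.1.2, x.2.1)‖ * ‖f (x.1.1, x.2.2)‖ -
      ‖f (x.1.1, x.2.1)‖ * ‖f (x.1.2, x.2.2)‖),
    sq_nonneg (‖f (x.1.2, x.2.1)‖ * ‖f (x.1.1, x.2.2)‖),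
    sq_nonneg (‖f (x.1.1, x.2.1)‖ * ‖f (x.1.2, x.2.2)‖)]

theorem hasSum_mul_conj {ι 𝕜 : Type*} [RCLike 𝕜] {f : ι → 𝕜} {a : 𝕜} (hf : HasSum f a) :
    HasSum (fun x : ι × ι => f x.1 * conj (f x.2)) ((‖a‖ ^ 2 : ℝ) : 𝕜) := by
  have hconj : HasSum (fun i => conj (f i)) (conj a) := hf.star
  have hs := summable_mul_of_summable_norm hf.summable.norm hconj.summable.norm
  have hmul := hf.mul hconj hs
  rwa [RCLike.mul_conj, ← RCLike.ofReal_pow] at hmul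

theorem hasSum_purity_reducedState (Ψ : Fock2) :
    HasSum (fun x : (ℕ × ℕ) × (ℕ × ℕ) => Ψ (x.1.2, x.2.1) * conj (Ψ (x.1.1, x.2.1)) *
      conj (Ψ (x.1.2, x.2.2) * conj (Ψ (x.1.1, x.2.2)))) (purity (reducedState Ψ) : ℂ) := by
  have hs := (summable_mul_conj_mul_conj (summable_sq Ψ)).hasSum
  have hentry (x : ℕ × ℕ) := hasSum_mul_conj (hasSum_reducedState_apply Ψ x.2 x.1)
  have hfiber := hs.prod_fiberwise hentry
  have hentries : Summable fun x : ℕ × ℕ => ‖reducedState Ψ (ket x.1) x.2‖ ^ 2 :=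
    Complex.summable_ofReal.1 hfiber.summable
  have hpurity : HasSum (fun x : ℕ × ℕ => ‖reducedState Ψ (ket x.1) x.2‖ ^ 2)
      (purity (reducedState Ψ)) := by
    rw [purity_eq_tsum_norm_sq (isSelfAdjoint_reducedState Ψ), tsum_congr fun n => norm_sq_eq _,
      ← hentries.tsum_prod]
    exact hentries.hasSum
  rw [(Complex.hasSum_ofReal.2 hpurity).unique hfiber]
  exact hs

/-- The term of the purity of the output state that comes from the amplitudes of `|m, k⟩`,
`|n, k⟩`, `|m, l⟩` and `|n, l⟩`, for an input with the scaled amplitudes `f`. -/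
def purityTerm (f : ℕ → ℂ) (T : ℝ) : (ℕ × ℕ) × (ℕ × ℕ) → ℂ
  | ((n, m), (k, l)) => f (m + k) * f (n + l) * conj (f (n + k) * f (m + l)) *
      ((T ^ n / n ! * (T ^ m / m !) * ((1 - T) ^ k / k ! * ((1 - T) ^ l / l !)) : ℝ) : ℂ)

theorem hasSum_purityTerm (ψ : Fock) {T : ℝ} (hT : T ∈ Set.Icc (0 : ℝ) 1) :
    HasSum (purityTerm (scaledAmplitude ψ) T) (outputPurity ψ T : ℂ) := by
  refine (hasSum_purity_reducedState (output ψ T)).congr_fun ?_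
  rintro ⟨⟨n, m⟩, ⟨k, l⟩⟩
  simp only [purityTerm, output_apply ψ hT, ← coherentAmplitude_sq hT.1,
    ← coherentAmplitude_sq (sub_nonneg.2 hT.2), map_mul, Complex.conj_conj, Complex.conj_ofReal]
  push_cast
  ring

theorem hasSum_sum_purityTerm (ψ : Fock) {T : ℝ} (hT : T ∈ Set.Icc (0 : ℝ) 1) :
    HasSum (fun N : ℕ => ∑ s ∈ antidiagonal N, ∑ x ∈ antidiagonal s.1 ×ˢ antidiagonal s.2,
      purityTerm (scaledAmplitude ψ) T x) (outputPurity ψ T : ℂ) := by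
  have hpairs := hasSum_sum_fiberwise (hasSum_purityTerm ψ hT)
    (fun x => (x.1.1 + x.1.2, x.2.1 + x.2.2))
    (fun s : ℕ × ℕ => antidiagonal s.1 ×ˢ antidiagonal s.2)
    fun x s => by simp [Prod.ext_iff]
  exact hasSum_sum_fiberwise hpairs (fun s : ℕ × ℕ => s.1 + s.2) (fun N : ℕ => antidiagonal N)
    fun _ _ => mem_antidiagonal

end Purity

section DividedPower

theorem inv_factorial_smul_add_pow {K A : Type*} [Field K] [CharZero K] [CommSemiring A]
    [Algebra K A] (a b : A) (n : ℕ) :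
    (n ! : K)⁻¹ • (a + b) ^ n =
      ∑ p ∈ antidiagonal n, ((p.1 ! : K)⁻¹ • a ^ p.1) * ((p.2 ! : K)⁻¹ • b ^ p.2) := by
  rw [(Commute.all a b).add_pow', smul_sum]
  refine sum_congr rfl fun p hp => ?_
  obtain rfl := mem_antidiagonal.1 hp
  have hfactorial : ((p.1 + p.2)! : K) ≠ 0 := Nat.cast_ne_zero.2 (Nat.factorial_ne_zero _)
  rw [smul_mul_smul_comm, ← Nat.cast_smul_eq_nsmul K, smul_smul, Nat.cast_add_choose]
  congr 1
  field_simp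

end DividedPower

section TwoCopies

variable {M A : Type*} [AddCommGroup M] [Module ℝ M] [CommRing A] [Algebra ℝ A]

/-- The form `p ⊗ q ↦ L p * conj (L q)`, through which the purity is read off from an identity of
tensors. It is only real-linear, so the tensor product is taken over `ℝ`. -/
def sesqForm (L : M →ₗ[ℝ] ℂ) : M ⊗[ℝ] M →ₗ[ℝ] ℂ :=
  LinearMap.mul' ℝ ℂ ∘ₗ TensorProduct.map L (Complex.conjAe.toLinearMap ∘ₗ L)

theorem sesqForm_tmul (L : M →ₗ[ℝ] ℂ) (p q : M) : sesqForm L (p ⊗ₜ q) = L p * conj (L q) := rfl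

theorem smul_tmul_swap_add_smul_tmul_self (T : ℝ) (x y : M) :
    T • (y ⊗ₜ[ℝ] x + x ⊗ₜ[ℝ] y) + (1 - T) • (x ⊗ₜ[ℝ] x + y ⊗ₜ[ℝ] y) =
      (1 / 2 : ℝ) • ((x + y) ⊗ₜ[ℝ] (x + y)) +
        ((1 / 2 : ℝ) * (1 - 2 * T)) • ((x - y) ⊗ₜ[ℝ] (x - y)) := by
  simp only [TensorProduct.add_tmul, TensorProduct.tmul_add, TensorProduct.sub_tmul,
    TensorProduct.tmul_sub]
  module

theorem sum_purityTerm_eq_sesqForm {f : ℕ → ℂ} {L : A →ₗ[ℝ] ℂ} {x y : A}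
    (hL : ∀ i j, L (x ^ i * y ^ j) = f i * f j) (T : ℝ) (N : ℕ) :
    ∑ s ∈ antidiagonal N, ∑ p ∈ antidiagonal s.1 ×ˢ antidiagonal s.2, purityTerm f T p =
      sesqForm L ((N ! : ℝ)⁻¹ •
        (T • (y ⊗ₜ[ℝ] x + x ⊗ₜ[ℝ] y) + (1 - T) • (x ⊗ₜ[ℝ] x + y ⊗ₜ[ℝ] y)) ^ N) := by
  rw [inv_factorial_smul_add_pow, map_sum]
  refine sum_congr rfl fun s _ => ?_
  rw [smul_add, smul_add, inv_factorial_smul_add_pow, inv_factorial_smul_add_pow, sum_mul_sum,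
    ← sum_product', map_sum]
  refine sum_congr rfl ?_
  rintro ⟨⟨n, m⟩, ⟨k, l⟩⟩ -
  have hleft : y ^ n * x ^ m * (x ^ k * y ^ l) = x ^ (m + k) * y ^ (n + l) := by ring
  have hright : x ^ n * y ^ m * (x ^ k * y ^ l) = x ^ (n + k) * y ^ (m + l) := by ring
  simp only [smul_pow, Algebra.TensorProduct.tmul_pow, smul_smul, smul_mul_smul_comm,
    Algebra.TensorProduct.tmul_mul_tmul, hleft, hright, map_smul, sesqForm_tmul, hL, purityTerm,
    Complex.real_smul]
  push_cast
  ring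

theorem sesqForm_eq_sum_norm_sq (L : A →ₗ[ℝ] ℂ) (u v : A) (t : ℝ) (N : ℕ) :
    sesqForm L ((N ! : ℝ)⁻¹ •
        ((1 / 2 : ℝ) • (u ⊗ₜ[ℝ] u) + ((1 / 2 : ℝ) * t) • (v ⊗ₜ[ℝ] v)) ^ N) =
      ((∑ s ∈ antidiagonal N, ((s.1 ! : ℝ) * s.2 !)⁻¹ * (1 / 2) ^ (s.1 + s.2) *
        ‖L (u ^ s.1 * v ^ s.2)‖ ^ 2 * t ^ s.2 : ℝ) : ℂ) := by
  rw [inv_factorial_smul_add_pow, map_sum, Complex.ofReal_sum]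
  refine sum_congr rfl fun s _ => ?_
  simp only [smul_pow, Algebra.TensorProduct.tmul_pow, smul_smul, smul_mul_smul_comm,
    Algebra.TensorProduct.tmul_mul_tmul, map_smul, sesqForm_tmul, Complex.mul_conj,
    Complex.normSq_eq_norm_sq, Complex.real_smul]
  push_cast
  ring

end TwoCopies

section Interference

open MvPolynomial (X)

/-- The linear functional on the polynomials in the creation operators `X 0`, `X 1` of two copies
of the input mode that pairs them with the product of two copies of the state with the scaled
amplitudes `f`. -/
def twoCopyFunctional (f : ℕ → ℂ) : MvPolynomial (Fin 2) ℝ →ₗ[ℝ] ℂ :=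
  (MvPolynomial.basisMonomials (Fin 2) ℝ).constr ℝ fun d => f (d 0) * f (d 1)

theorem twoCopyFunctional_monomial (f : ℕ → ℂ) (d : Fin 2 →₀ ℕ) :
    twoCopyFunctional f (MvPolynomial.monomial d 1) = f (d 0) * f (d 1) := by
  rw [twoCopyFunctional, ← congrFun (MvPolynomial.coe_basisMonomials ..) d,
    Module.Basis.constr_basis]

theorem twoCopyFunctional_X_pow_mul_X_pow (f : ℕ → ℂ) (i j : ℕ) :
    twoCopyFunctional f (X 0 ^ i * X 1 ^ j) = f i * f j := by
  rw [MvPolynomial.X_pow_eq_monomial, MvPolynomial.X_pow_eq_monomial, MvPolynomial.monomial_mul,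
    mul_one, twoCopyFunctional_monomial]
  simp

theorem twoCopyFunctional_rename_swap (f : ℕ → ℂ) (p : MvPolynomial (Fin 2) ℝ) :
    twoCopyFunctional f (MvPolynomial.rename (Equiv.swap 0 1) p) = twoCopyFunctional f p := by
  suffices h : twoCopyFunctional f ∘ₗ (MvPolynomial.rename (Equiv.swap 0 1)).toLinearMap =
      twoCopyFunctional f from LinearMap.congr_fun h p
  refine (MvPolynomial.basisMonomials (Fin 2) ℝ).ext fun d => ?_
  simp [MvPolynomial.rename_monomial, twoCopyFunctional_monomial, Finsupp.mapDomain_equiv_apply,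
    mul_comm]

/-- The amplitude, up to normalization, of `s.1` photons in the output mode `X 0 + X 1` and `s.2`
photons in the output mode `X 0 - X 1` when two copies of the input interfere on a balanced beam
splitter. -/
def interferenceAmplitude (f : ℕ → ℂ) (s : ℕ × ℕ) : ℂ :=
  twoCopyFunctional f ((X 0 + X 1) ^ s.1 * (X 0 - X 1) ^ s.2)

theorem interferenceAmplitude_of_odd (f : ℕ → ℂ) {s : ℕ × ℕ} (hs : Odd s.2) :
    interferenceAmplitude f s = 0 := by
  have hswap : MvPolynomial.rename (Equiv.swap 0 1) ((X 0 + X 1) ^ s.1 * (X 0 - X 1) ^ s.2) =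
      -((X 0 + X 1) ^ s.1 * (X 0 - X 1) ^ s.2 : MvPolynomial (Fin 2) ℝ) := by
    simp only [map_mul, map_pow, map_add, map_sub, MvPolynomial.rename_X, Equiv.swap_apply_left,
      Equiv.swap_apply_right]
    rw [← neg_sub (X 0), hs.neg_pow, add_comm (X 1), mul_neg]
  have h := twoCopyFunctional_rename_swap f ((X 0 + X 1) ^ s.1 * (X 0 - X 1) ^ s.2)
  rw [hswap, map_neg] at h
  exact self_eq_neg.1 h.symm

/-- The probability, up to normalization, of the outcome with amplitude
`interferenceAmplitude f s`. -/
def interferenceWeight (f : ℕ → ℂ) (s : ℕ × ℕ) : ℝ :=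
  ((s.1 ! : ℝ) * s.2 !)⁻¹ * (1 / 2) ^ (s.1 + s.2) * ‖interferenceAmplitude f s‖ ^ 2

theorem interferenceWeight_nonneg (f : ℕ → ℂ) (s : ℕ × ℕ) : 0 ≤ interferenceWeight f s := by
  unfold interferenceWeight
  positivity

theorem interferenceWeight_of_odd (f : ℕ → ℂ) {s : ℕ × ℕ} (hs : Odd s.2) :
    interferenceWeight f s = 0 := by
  simp [interferenceWeight, interferenceAmplitude_of_odd f hs]

theorem sum_purityTerm_eq_sum_interferenceWeight (f : ℕ → ℂ) (T : ℝ) (N : ℕ) :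
    ∑ s ∈ antidiagonal N, ∑ x ∈ antidiagonal s.1 ×ˢ antidiagonal s.2, purityTerm f T x =
      ((∑ s ∈ antidiagonal N, interferenceWeight f s * (1 - 2 * T) ^ s.2 : ℝ) : ℂ) := by
  rw [sum_purityTerm_eq_sesqForm (twoCopyFunctional_X_pow_mul_X_pow f),
    smul_tmul_swap_add_smul_tmul_self, sesqForm_eq_sum_norm_sq]
  rfl

theorem hasSum_outputPurity (ψ : Fock) {T : ℝ} (hT : T ∈ Set.Icc (0 : ℝ) 1) :
    HasSum (fun N => ∑ s ∈ antidiagonal N,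
      interferenceWeight (scaledAmplitude ψ) s * (1 - 2 * T) ^ s.2) (outputPurity ψ T) := by
  have h := hasSum_sum_purityTerm ψ hT
  simp only [sum_purityTerm_eq_sum_interferenceWeight] at h
  exact Complex.hasSum_ofReal.1 h

theorem convexOn_interferenceWeight_mul_pow (f : ℕ → ℂ) (s : ℕ × ℕ) :
    ConvexOn ℝ Set.univ fun T : ℝ => interferenceWeight f s * (1 - 2 * T) ^ s.2 := by
  rcases Nat.even_or_odd s.2 with hs | hs
  · have h := (hs.convexOn_pow (𝕜 := ℝ)).comp_affineMap (AffineMap.lineMap 1 (-1))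
    have hline (T : ℝ) : AffineMap.lineMap (1 : ℝ) (-1) T = 1 - 2 * T := by
      rw [AffineMap.lineMap_apply_ring']
      ring
    refine (h.smul (interferenceWeight_nonneg f s)).congr fun T _ => ?_
    simp only [Function.comp_apply, hline, smul_eq_mul]
  · simpa [interferenceWeight_of_odd f hs] using convexOn_const (0 : ℝ) convex_univ

theorem interferenceWeight_mul_pow_half_le (f : ℕ → ℂ) (s : ℕ × ℕ) (T : ℝ) :
    interferenceWeight f s * (1 - 2 * (1 / 2)) ^ s.2 ≤
      interferenceWeight f s * (1 - 2 * T) ^ s.2 := by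
  rcases Nat.even_or_odd s.2 with hs | hs
  · refine mul_le_mul_of_nonneg_left ?_ (interferenceWeight_nonneg f s)
    rcases eq_or_ne s.2 0 with h0 | h0
    · simp [h0]
    · simpa [h0] using hs.pow_nonneg (1 - 2 * T)
  · simp [interferenceWeight_of_odd f hs]

end Interference

theorem convexOn_outputPurity (ψ : Fock) : ConvexOn ℝ (Set.Icc 0 1) (outputPurity ψ) := by
  refine convexOn_of_hasSum (convex_Icc 0 1) (fun N => ?_) fun T hT => hasSum_outputPurity ψ hT
  refine convexOn_of_hasSum (convex_Icc 0 1) (fun s => ?_) fun T _ => (antidiagonal N).hasSum _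
  exact (convexOn_interferenceWeight_mul_pow _ s.1).subset (Set.subset_univ _) (convex_Icc 0 1)

theorem isMinOn_outputPurity (ψ : Fock) : IsMinOn (outputPurity ψ) (Set.Icc 0 1) (1 / 2) := by
  refine isMinOn_of_hasSum ⟨by norm_num, by norm_num⟩ (fun N => ?_)
    fun T hT => hasSum_outputPurity ψ hT
  exact isMinOn_iff.2 fun T _ => sum_le_sum fun s _ => interferenceWeight_mul_pow_half_le _ s T

end BeamSplitter

end

theorem corollary2_general (ψ : BeamSplitter.Fock) :
    ConvexOn ℝ (Set.Icc 0 1) (BeamSplitter.outputPurity ψ) ∧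
      IsMinOn (BeamSplitter.outputPurity ψ) (Set.Icc 0 1) (1 / 2) ∧
      ConcaveOn ℝ (Set.Icc 0 1) (BeamSplitter.outputMixedness ψ) ∧
      IsMaxOn (BeamSplitter.outputMixedness ψ) (Set.Icc 0 1) (1 / 2) := by
  have hconvex := BeamSplitter.convexOn_outputPurity ψ
  have hmin := BeamSplitter.isMinOn_outputPurity ψ
  refine ⟨hconvex, hmin, ?_, ?_⟩
  · exact (concaveOn_const (1 : ℝ) (convex_Icc 0 1)).sub hconvex
  · exact isMaxOn_iff.2 fun T hT => sub_le_sub_left (isMinOn_iff.1 hmin T hT) 1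

theorem corollary2 (ψ : BeamSplitter.Fock) (hψ : ‖ψ‖ = 1) :
    ConvexOn ℝ (Set.Icc 0 1) (BeamSplitter.outputPurity ψ) ∧
      IsMinOn (BeamSplitter.outputPurity ψ) (Set.Icc 0 1) (1 / 2) ∧
      ConcaveOn ℝ (Set.Icc 0 1) (BeamSplitter.outputMixedness ψ) ∧
      IsMaxOn (BeamSplitter.outputMixedness ψ) (Set.Icc 0 1) (1 / 2) :=
  corollary2_general ψ
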